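/- Let $\mathbb H$ be the upper half plane with its hyperbolic metric, let $SL_2\mathbb R$ act on it by fractional linear transformations, and let $PSL_2\mathbb R=SL_2\mathbb R/\{\pm1\}$, the group of orientation-preserving isometries of $\mathbb H$. Let $\widetilde{PSL_2\mathbb R}$ be the universal cover of $PSL_2\mathbb R$, i.e. the set of homotopy classes (relative to endpoints) of paths in $PSL_2\mathbb R$ starting at $1$; it is identified with the universal cover $\widetilde{SL_2\mathbb R}$ of $SL_2\mathbb R$ by the projection $SL_2\mathbb R\to PSL_2\mathbb R$. **Milnor's angle function.** Every $A\in SL_2\mathbb R$ is uniquely $A=R(A)S(A)$ with $R(A)\in SO_2\mathbb R$ and $S(A)$ symmetric positive definite. The continuous map $R$ lifts to $\widetilde R:\widetilde{SL_2\mathbb R}\to\widetilde{SO_2\mathbb R}$, and the map $\exp:\mathbb R\to SO_2\mathbb R$, $\theta\mapsto\begin{pmatrix}\cos\theta&\sin\theta\\-\sin\theta&\cos\theta\end{pmatrix}$, lifts to a bijection $\widetilde{\exp}:\mathbb R\to\widetilde{SO_2\mathbb R}$ (both lifts preserve base points). Put $\Theta(\tilde\alpha)=\widetilde{\exp}^{-1}\bigl(\widetilde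 R(\tilde\alpha)\bigr)$. **Twist.** $PSL_2\mathbb R$ acts simply transitively on the unit tangent bundle $UT\mathbb H$. A path $V:[0,1]\to UT\mathbb H$ is said to lie in the class $\tilde\alpha\in\widetilde{PSL_2\mathbb R}$ if the path $\gamma$ in $PSL_2\mathbb R$ with $\gamma(0)=1$ and $V(t)=\gamma(t)\cdot V(0)$ represents $\tilde\alpha$. Let $\tilde\alpha$ cover $\alpha\in PSL_2\mathbb R$, let $y\in\mathbb H$, let $c:[0,1]\to\mathbb H$ be the geodesic of constant speed (possibly $0$) from $y$ to $\alpha(y)$, and let $V$ be a continuous unit tangent vector field along $c$ that lies in the class $\tilde\alpha$. Let $\hat c(t)$ be the velocity of $c$ rescaled to unit length (any constant unit vector, if $c$ is constant), and let $\theta:[0,1]\to\mathbb R$ be a continuous choice of the anticlockwise angle from $\hat c(t)$ to $V(t)$. Then $\operatorname{Twist}(\tilde\alpha,y)=\theta(1)-\theta(0)$. **Proposition.** For every $\tilde\alpha\in\widetilde{PSL_2\mathbb R}$, the number $\operatorname{Twist}(\tilde\alpha,i)$ exists and does not depend on the choices made, and $$\Theta(\tilde\alpha)=\tfrac12\operatorname{Twist}(\tilde\alpha,i).$$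 -/

import Mathlib

open scoped MatrixGroups UpperHalfPlane unitInterval

namespace HypTwist

/-! ### Universal covers as homotopy classes of based paths -/

section UniversalCover

variable {X Y : Type*} [TopologicalSpace X] [TopologicalSpace Y]

/-- Paths `[0,1] → X` that start at the base point `x₀`. -/
abbrev BasedPath (X : Type*) [TopologicalSpace X] (x₀ : X) : Type _ := {γ : C(I, X) // γ 0 = x₀}

/-- Two based paths are identified when they are homotopic relative to both endpoints
(in particular they have the same final point). -/
instance basedPathSetoid (X : Type*) [TopologicalSpace X] (x₀ : X) : Setoid (BasedPath X x₀) where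
  r γ γ' := ContinuousMap.HomotopicRel γ.1 γ'.1 {0, 1}
  iseqv := ⟨fun γ => .refl γ.1, fun h => h.symm, fun h h' => h.trans h'⟩

/-- The universal cover of `X` (with base point `x₀`): homotopy classes, relative to the endpoints,
of paths in `X` that start at `x₀`. -/
def UniversalCover (X : Type*) [TopologicalSpace X] (x₀ : X) : Type _ :=
  Quotient (basedPathSetoid X x₀)

namespace UniversalCover

/-- The class of a based path. -/
def mk {x₀ : X} (γ : BasedPath X x₀) : UniversalCover X x₀ := Quotient.mk _ γ

/-- The map of universal covers induced by a base point preserving continuous map: it is the lift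
of `f` that maps the base point to the base point. -/
def map (f : C(X, Y)) {x₀ : X} {y₀ : Y} (h : f x₀ = y₀) :
    UniversalCover X x₀ → UniversalCover Y y₀ :=
  Quotient.map' (fun γ => ⟨f.comp γ.1, by simp [γ.2, h]⟩) fun _ _ hγ => hγ.map fun H =>
    H.compContinuousMap f

/-- A covering map induces a bijection of universal covers. -/
theorem map_bijective (f : C(X, Y)) (hf : IsCoveringMap f) {x₀ : X} {y₀ : Y} (h : f x₀ = y₀) :
    Function.Bijective (map f h) := by
  constructor
  · intro a b
    induction a using Quotient.inductionOn with | _ a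
    induction b using Quotient.inductionOn with | _ b
    intro hab
    exact Quotient.sound ((hf.homotopicRel_iff_comp ⟨0, by simp, a.2.trans b.2.symm⟩).2
      (Quotient.exact hab))
  · intro b
    induction b using Quotient.inductionOn with | _ b
    have h0 : b.1 0 = f x₀ := b.2.trans h.symm
    refine ⟨mk ⟨hf.liftPath b.1 x₀ h0, hf.liftPath_zero _ _ _⟩, ?_⟩
    refine congrArg (Quotient.mk _) (Subtype.ext (ContinuousMap.ext fun t => ?_))
    exact congrFun (hf.liftPath_lifts b.1 x₀ h0) t

end UniversalCover

end UniversalCover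

/-! ### The groups `SL₂(ℝ)`, `PSL₂(ℝ)` and their common universal cover -/

/-- The projection `SL₂(ℝ) → PSL₂(ℝ)`. -/
def toPSL : C(SL(2, ℝ), PSL(2, ℝ)) := ⟨fun g => (g : PSL(2, ℝ)), continuous_quot_mk⟩

theorem isCoveringMap_toPSL : IsCoveringMap toPSL := by
  have hfin : Finite (Subgroup.center SL(2, ℝ)) :=
    Finite.of_equiv _ (Matrix.SpecialLinearGroup.center_equiv_rootsOfUnity' (0 : Fin 2)).symm.toEquiv
  exact ((Subgroup.center SL(2, ℝ)).isQuotientCoveringMap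
    (Set.Finite.isDiscrete (Set.toFinite _))).isCoveringMap

/-- The universal cover of `SL₂(ℝ)`. -/
abbrev SLTilde : Type := UniversalCover SL(2, ℝ) 1

/-- The universal cover of `PSL₂(ℝ)`. -/
abbrev PSLTilde : Type := UniversalCover PSL(2, ℝ) 1

/-- The identification of the universal covers of `SL₂(ℝ)` and `PSL₂(ℝ)` induced by the projection
`SL₂(ℝ) → PSL₂(ℝ)`. -/
noncomputable def tildeEquiv : SLTilde ≃ PSLTilde :=
  Equiv.ofBijective (UniversalCover.map toPSL rfl) (UniversalCover.map_bijective _ isCoveringMap_toPSL rfl)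

/-! ### Milnor's angle function -/

/-- The group `SO₂(ℝ)`. -/
abbrev SO2 : Type := Matrix.specialOrthogonalGroup (Fin 2) ℝ

theorem sq_add_sq_pos (A : SL(2, ℝ)) :
    0 < (A 0 0 + A 1 1) ^ 2 + (A 0 1 - A 1 0) ^ 2 := by
  have h := A.det_coe
  rw [Matrix.det_fin_two] at h
  nlinarith [sq_nonneg (A 0 0 - A 1 1), sq_nonneg (A 0 1 + A 1 0)]

theorem polar_formula {A : SL(2, ℝ)} {R : SO2} {S : Matrix (Fin 2) (Fin 2) ℝ}
    (hS : S.PosDef) (h : (A : Matrix (Fin 2) (Fin 2) ℝ) = (R : Matrix (Fin 2) (Fin 2) ℝ) * S) :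
    (R : Matrix (Fin 2) (Fin 2) ℝ) 0 0 =
        (A 0 0 + A 1 1) / √((A 0 0 + A 1 1) ^ 2 + (A 0 1 - A 1 0) ^ 2) ∧
      (R : Matrix (Fin 2) (Fin 2) ℝ) 0 1 =
        (A 0 1 - A 1 0) / √((A 0 0 + A 1 1) ^ 2 + (A 0 1 - A 1 0) ^ 2) := by
  obtain ⟨h1, h2, h3⟩ := Matrix.mem_specialOrthogonalGroup_fin_two_iff.1 R.2
  have hs : S 0 1 = S 1 0 := by simpa using (hS.1.apply 0 1).symm
  have p0 : 0 < S 0 0 := hS.diag_pos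
  have p1 : 0 < S 1 1 := hS.diag_pos
  have e (i j : Fin 2) := congrFun (congrFun h i) j
  simp only [Matrix.mul_apply, Fin.sum_univ_two] at e
  have e1 : A 0 0 + A 1 1 = R.1 0 0 * (S 0 0 + S 1 1) := by
    rw [e 0 0, e 1 1]; linear_combination (S 1 1) * (-h1) + (S 0 1) * h2 - R.1 0 1 * hs
  have e2 : A 0 1 - A 1 0 = R.1 0 1 * (S 0 0 + S 1 1) := by
    rw [e 0 1, e 1 0]; linear_combination R.1 0 0 * hs + S 1 0 * h1 - S 0 0 * h2
  have e3 : √((A 0 0 + A 1 1) ^ 2 + (A 0 1 - A 1 0) ^ 2) = S 0 0 + S 1 1 := by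
    rw [e1, e2, show (R.1 0 0 * (S 0 0 + S 1 1)) ^ 2 + (R.1 0 1 * (S 0 0 + S 1 1)) ^ 2
      = (S 0 0 + S 1 1) ^ 2 by linear_combination (S 0 0 + S 1 1) ^ 2 * h3]
    exact Real.sqrt_sq (by positivity)
  have : S 0 0 + S 1 1 ≠ 0 := by positivity
  rw [e3, e1, e2]
  constructor <;> field_simp

/-- Polar decomposition: every `A ∈ SL₂(ℝ)` is `R * S` for a unique `R ∈ SO₂(ℝ)` and a symmetric
positive definite `S`. -/
theorem existsUnique_polar (A : SL(2, ℝ)) :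
    ∃! R : SO2, ∃ S : Matrix (Fin 2) (Fin 2) ℝ, S.PosDef ∧
      (A : Matrix (Fin 2) (Fin 2) ℝ) = (R : Matrix (Fin 2) (Fin 2) ℝ) * S := by
  have hN := sq_add_sq_pos A
  have hdet := A.det_coe
  rw [Matrix.det_fin_two] at hdet
  obtain ⟨N, hN0, hN2⟩ : ∃ N : ℝ, 0 < N ∧ N ^ 2 = (A 0 0 + A 1 1) ^ 2 + (A 0 1 - A 1 0) ^ 2 :=
    ⟨√((A 0 0 + A 1 1) ^ 2 + (A 0 1 - A 1 0) ^ 2), Real.sqrt_pos.2 hN, Real.sq_sqrt hN.le⟩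
  obtain ⟨p, hp⟩ : ∃ p, p * N = A 0 0 + A 1 1 := ⟨(A 0 0 + A 1 1) / N, by field_simp⟩
  obtain ⟨q, hq⟩ : ∃ q, q * N = A 0 1 - A 1 0 := ⟨(A 0 1 - A 1 0) / N, by field_simp⟩
  have hpq : p ^ 2 + q ^ 2 = 1 := by
    have : N ^ 2 * (p ^ 2 + q ^ 2) = N ^ 2 * 1 := by linear_combination (p * N + (A 0 0 + A 1 1)) * hp + (q * N + (A 0 1 - A 1 0)) * hq - hN2
    exact mul_left_cancel₀ (by positivity) this
  have hR : !![p, q; -q, p] ∈ Matrix.specialOrthogonalGroup (Fin 2) ℝ := by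
    rw [Matrix.of_mem_specialOrthogonalGroup_fin_two_iff]
    exact ⟨rfl, by ring, hpq⟩
  refine ⟨⟨_, hR⟩, ⟨!![p * A 0 0 - q * A 1 0, p * A 0 1 - q * A 1 1;
      q * A 0 0 + p * A 1 0, q * A 0 1 + p * A 1 1], ?_, ?_⟩, ?_⟩
  · have hsymm : p * A 0 1 - q * A 1 1 = q * A 0 0 + p * A 1 0 := by
      have : N * (p * A 0 1 - q * A 1 1) = N * (q * A 0 0 + p * A 1 0) := by
        linear_combination (A 0 1 - A 1 0) * hp - (A 0 0 + A 1 1) * hq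
      exact mul_left_cancel₀ hN0.ne' this
    have htr : (p * A 0 0 - q * A 1 0) + (q * A 0 1 + p * A 1 1) = N := by
      have : N * ((p * A 0 0 - q * A 1 0) + (q * A 0 1 + p * A 1 1)) = N * N := by
        linear_combination (A 0 0 + A 1 1) * hp + (A 0 1 - A 1 0) * hq - hN2
      exact mul_left_cancel₀ hN0.ne' this
    have hd : (p * A 0 0 - q * A 1 0) * (q * A 0 1 + p * A 1 1)
        - (p * A 0 1 - q * A 1 1) * (q * A 0 0 + p * A 1 0) = 1 := by
      linear_combination (A 0 0 * A 1 1 - A 0 1 * A 1 0) * hpq + hdet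
    rw [← hsymm] at hd ⊢
    generalize p * A 0 0 - q * A 1 0 = s at *
    generalize p * A 0 1 - q * A 1 1 = t at *
    generalize q * A 0 1 + p * A 1 1 = u at *
    have hs : 0 < s := by
      by_contra hs
      nlinarith [sq_nonneg t, sq_nonneg s]
    refine Matrix.PosDef.of_dotProduct_mulVec_pos ?_ fun x hx => ?_
    · ext i j
      fin_cases i <;> fin_cases j <;> simp
    · simp only [star_trivial, dotProduct, Matrix.mulVec, Fin.sum_univ_two, Matrix.of_apply,
        Matrix.cons_val_zero, Matrix.cons_val_one, Matrix.cons_val', Matrix.cons_val_fin_one]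
      have hx' : 0 < (s * x 0 + t * x 1) ^ 2 + (x 1) ^ 2 := by
        by_cases h1 : x 1 = 0
        · have h0 : x 0 ≠ 0 := by
            intro h0
            exact hx (by ext i; fin_cases i <;> simp [h0, h1])
          rw [h1]
          have := mul_ne_zero hs.ne' h0
          simp only [mul_zero, add_zero, ne_eq, OfNat.ofNat_ne_zero, not_false_eq_true, zero_pow]
          positivity
        · positivity
      have : 0 < s * (x 0 * (s * x 0 + t * x 1) + x 1 * (t * x 0 + u * x 1)) := by
        have : s * (x 0 * (s * x 0 + t * x 1) + x 1 * (t * x 0 + u * x 1))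
          = (s * x 0 + t * x 1) ^ 2 + (x 1) ^ 2 := by linear_combination x 1 ^ 2 * hd
        rwa [this]
      exact (pos_iff_pos_of_mul_pos this).1 hs
  · ext i j
    fin_cases i <;> fin_cases j <;>
      simp [Matrix.mul_apply, Fin.sum_univ_two]
    · linear_combination -(A 0 0) * hpq
    · linear_combination -(A 0 1) * hpq
    · linear_combination -(A 1 0) * hpq
    · linear_combination -(A 1 1) * hpq
  · rintro R ⟨S, hS, hA⟩
    obtain ⟨f0, f1⟩ := polar_formula hS hA
    obtain ⟨h1, h2, h3⟩ := Matrix.mem_specialOrthogonalGroup_fin_two_iff.1 R.2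
    rw [← hN2, Real.sqrt_sq hN0.le, ← hp, mul_div_cancel_right₀ _ hN0.ne'] at f0
    rw [← hN2, Real.sqrt_sq hN0.le, ← hq, mul_div_cancel_right₀ _ hN0.ne'] at f1
    ext i j
    fin_cases i <;> fin_cases j <;> simp [f0, f1]
    · rw [← f1, h2, neg_neg]
    · rw [← f0, h1]

/-- The rotation part `R(A)` of the polar decomposition `A = R(A) S(A)` with `R(A) ∈ SO₂(ℝ)` and
`S(A)` symmetric positive definite. -/
noncomputable def polarRotation (A : SL(2, ℝ)) : SO2 := (existsUnique_polar A).choose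

theorem polarRotation_spec (A : SL(2, ℝ)) : ∃ S : Matrix (Fin 2) (Fin 2) ℝ, S.PosDef ∧
    (A : Matrix (Fin 2) (Fin 2) ℝ) = (polarRotation A : Matrix (Fin 2) (Fin 2) ℝ) * S :=
  (existsUnique_polar A).choose_spec.1

theorem polarRotation_one : polarRotation 1 = 1 :=
  ((existsUnique_polar 1).choose_spec.2 1 ⟨1, Matrix.PosDef.one, by simp⟩).symm

theorem continuous_polarRotation : Continuous polarRotation := by
  refine Continuous.subtype_mk (f := fun A => (polarRotation A : Matrix (Fin 2) (Fin 2) ℝ)) ?_ _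
  have hc (i j : Fin 2) : Continuous fun A : SL(2, ℝ) => A i j := by fun_prop
  have key (A : SL(2, ℝ)) := let ⟨_, hS, hA⟩ := polarRotation_spec A; polar_formula hS hA
  have hs (A : SL(2, ℝ)) : √((A 0 0 + A 1 1) ^ 2 + (A 0 1 - A 1 0) ^ 2) ≠ 0 :=
    (Real.sqrt_pos.2 (sq_add_sq_pos A)).ne'
  have hsc : Continuous fun A : SL(2, ℝ) => √((A 0 0 + A 1 1) ^ 2 + (A 0 1 - A 1 0) ^ 2) :=
    (((hc 0 0).add (hc 1 1)).pow 2 |>.add (((hc 0 1).sub (hc 1 0)).pow 2)).sqrt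
  have c0 : Continuous fun A => (polarRotation A : Matrix (Fin 2) (Fin 2) ℝ) 0 0 := by
    simp only [fun A => (key A).1]
    exact ((hc 0 0).add (hc 1 1)).div hsc hs
  have c1 : Continuous fun A => (polarRotation A : Matrix (Fin 2) (Fin 2) ℝ) 0 1 := by
    simp only [fun A => (key A).2]
    exact ((hc 0 1).sub (hc 1 0)).div hsc hs
  have hm (A : SL(2, ℝ)) := Matrix.mem_specialOrthogonalGroup_fin_two_iff.1 (polarRotation A).2
  refine continuous_matrix fun i j => ?_
  fin_cases i <;> fin_cases j
  · exact c0
  · exact c1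
  · refine c1.neg.congr fun A => ?_
    have := (hm A).2.1
    simp [this]
  · exact c0.congr fun A => (hm A).1

/-- The lift `R̃` to the universal covers of the retraction `R : SL₂(ℝ) → SO₂(ℝ)`. -/
noncomputable def polarRotationTilde : SLTilde → UniversalCover SO2 1 :=
  UniversalCover.map ⟨polarRotation, continuous_polarRotation⟩ polarRotation_one

/-- The exponential map `θ ↦ !![cos θ, sin θ; -sin θ, cos θ]` of `SO₂(ℝ)`. -/
noncomputable def expSO2 : C(ℝ, SO2) where
  toFun θ := ⟨!![Real.cos θ, Real.sin θ; -Real.sin θ, Real.cos θ], by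
    rw [Matrix.of_mem_specialOrthogonalGroup_fin_two_iff]
    exact ⟨rfl, by ring, Real.cos_sq_add_sin_sq θ⟩⟩
  continuous_toFun := by
    refine Continuous.subtype_mk ?_ _
    refine continuous_matrix fun i j => ?_
    fin_cases i <;> fin_cases j <;> simp <;> fun_prop

theorem expSO2_zero : expSO2 0 = 1 := by
  ext i j
  fin_cases i <;> fin_cases j <;> simp [expSO2]

/-- The homeomorphism between the unit circle and `SO₂(ℝ)`, which sends `exp (i θ)` to
`expSO2 θ`. -/
noncomputable def circleHomeoSO2 : Circle ≃ₜ SO2 where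
  toFun z := ⟨!![(z : ℂ).re, (z : ℂ).im; -(z : ℂ).im, (z : ℂ).re], by
    rw [Matrix.of_mem_specialOrthogonalGroup_fin_two_iff]
    refine ⟨rfl, by ring, ?_⟩
    have := Circle.normSq_coe z
    rw [Complex.normSq_apply] at this
    linear_combination this⟩
  invFun R := ⟨⟨(R : Matrix (Fin 2) (Fin 2) ℝ) 0 0, (R : Matrix (Fin 2) (Fin 2) ℝ) 0 1⟩, by
    obtain ⟨h1, h2, h3⟩ := Matrix.mem_specialOrthogonalGroup_fin_two_iff.1 R.2
    rw [Submonoid.unitSphere, ← SetLike.mem_coe]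
    simp only [Submonoid.coe_set_mk, Subsemigroup.coe_set_mk, mem_sphere_zero_iff_norm]
    rw [← sq_eq_sq₀ (norm_nonneg _) zero_le_one, Complex.sq_norm, Complex.normSq_apply]
    linear_combination h3⟩
  left_inv z := by ext; simp
  right_inv R := by
    obtain ⟨h1, h2, h3⟩ := Matrix.mem_specialOrthogonalGroup_fin_two_iff.1 R.2
    ext i j
    fin_cases i <;> fin_cases j <;> simp [h1, h2]
  continuous_toFun := by
    refine Continuous.subtype_mk ?_ _
    refine continuous_matrix fun i j => ?_
    fin_cases i <;> fin_cases j <;> simp <;> fun_prop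
  continuous_invFun := by
    refine Continuous.subtype_mk ?_ _
    have hc (i j : Fin 2) : Continuous fun R : SO2 => (R : Matrix (Fin 2) (Fin 2) ℝ) i j :=
      continuous_subtype_val.matrix_elem i j
    exact Complex.equivRealProdCLM.symm.continuous.comp ((hc 0 0).prodMk (hc 0 1))

theorem isCoveringMap_expSO2 : IsCoveringMap expSO2 := by
  have h : (expSO2 : ℝ → SO2) = circleHomeoSO2 ∘ Circle.exp := by
    funext θ
    refine Subtype.ext ?_
    change !![Real.cos θ, Real.sin θ; -Real.sin θ, Real.cos θ] =
      !![(Circle.exp θ : ℂ).re, (Circle.exp θ : ℂ).im;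
        -(Circle.exp θ : ℂ).im, (Circle.exp θ : ℂ).re]
    rw [Circle.coe_exp, Complex.exp_ofReal_mul_I_re, Complex.exp_ofReal_mul_I_im]
  rw [h]
  exact (Circle.isAddQuotientCoveringMap_exp.homeomorph_comp circleHomeoSO2).isCoveringMap

/-- The lift `ℝ → S̃O₂(ℝ)` of the exponential map: `θ` is sent to the class of the path
`t ↦ exp (t θ)`. -/
noncomputable def expTilde (θ : ℝ) : UniversalCover SO2 1 :=
  UniversalCover.mk ⟨expSO2.comp ⟨fun t : I => (t : ℝ) * θ, by fun_prop⟩, by simp [expSO2_zero]⟩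

theorem expTilde_bijective : Function.Bijective expTilde := by
  let seg (θ : ℝ) : UniversalCover ℝ 0 :=
    UniversalCover.mk ⟨⟨fun t : I => (t : ℝ) * θ, by fun_prop⟩, by simp⟩
  have hcomp : expTilde = UniversalCover.map expSO2 expSO2_zero ∘ seg := rfl
  rw [hcomp]
  refine (UniversalCover.map_bijective _ isCoveringMap_expSO2 _).comp ⟨fun a b hab => ?_, fun x => ?_⟩
  · have h : ContinuousMap.HomotopicRel _ _ _ := Quotient.exact hab
    obtain ⟨H⟩ := h
    have := H.fst_eq_snd (x := 1) (by simp)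
    simpa using this
  · induction x using Quotient.inductionOn with | _ γ
    refine ⟨γ.1 1, Quotient.sound ⟨⟨⟨⟨fun p : I × I =>
      (1 - (p.1 : ℝ)) * ((p.2 : ℝ) * γ.1 1) + (p.1 : ℝ) * γ.1 p.2, by fun_prop⟩, ?_, ?_⟩, ?_⟩⟩⟩
    · intro t; simp
    · intro t; simp
    · rintro s t (rfl | rfl)
      · simp [γ.2]
      · simp
        ring

/-- The identification of `ℝ` with the universal cover of `SO₂(ℝ)` by the lifted exponential map. -/
noncomputable def expTildeEquiv : ℝ ≃ UniversalCover SO2 1 :=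
  Equiv.ofBijective expTilde expTilde_bijective

/-- Milnor's angle function `Θ(α̃) = (exp~)⁻¹ (R̃ α̃)` on the universal cover. -/
noncomputable def milnorTheta (α : PSLTilde) : ℝ :=
  expTildeEquiv.symm (polarRotationTilde (tildeEquiv.symm α))

/-! ### The unit tangent bundle of the hyperbolic plane -/

/-- The unit tangent bundle of the upper half plane: tangent vectors `v ∈ ℂ` at `z ∈ ℍ` of
hyperbolic length `‖v‖ / Im z = 1`. -/
abbrev UTH : Type := {p : ℍ × ℂ // ‖p.2‖ = p.1.im}

/-- The base point of a unit tangent vector. -/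
def UTH.base (u : UTH) : ℍ := u.1.1

/-- A unit tangent vector as a complex number. -/
def UTH.vec (u : UTH) : ℂ := u.1.2

/-- The denominator `c z + d` of a fractional linear transformation. -/
noncomputable def cdenom (g : SL(2, ℝ)) (z : ℍ) : ℂ := (g 1 0 : ℂ) * z + (g 1 1 : ℂ)

theorem cdenom_ne_zero (g : SL(2, ℝ)) (z : ℍ) : cdenom g z ≠ 0 :=
  UpperHalfPlane.denom_ne_zero (g : GL (Fin 2) ℝ) z

theorem cdenom_mul (g h : SL(2, ℝ)) (z : ℍ) :
    cdenom (g * h) z = cdenom g (h • z) * cdenom h z := by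
  have hn := cdenom_ne_zero h z
  have hz := UpperHalfPlane.coe_specialLinearGroup_apply h z
  have : ((h • z : ℍ) : ℂ) * cdenom h z = (h 0 0 : ℂ) * z + (h 0 1 : ℂ) := by
    rw [hz]; exact div_mul_cancel₀ _ hn
  simp only [cdenom, Matrix.SpecialLinearGroup.coe_mul, Matrix.mul_apply, Fin.sum_univ_two] at this ⊢
  push_cast
  linear_combination -(g 1 0 : ℂ) * this

/-- The derivative at `z` of the fractional linear transformation of `g` is `1 / (c z + d) ^ 2`. -/
theorem hasDerivAt_moebius (g : SL(2, ℝ)) (z : ℍ) :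
    HasDerivAt (fun w : ℂ => ((g 0 0 : ℂ) * w + (g 0 1 : ℂ)) / ((g 1 0 : ℂ) * w + (g 1 1 : ℂ)))
      (1 / cdenom g z ^ 2) (z : ℂ) := by
  have hdet : (g 0 0 : ℂ) * g 1 1 - g 0 1 * g 1 0 = 1 := by
    have h := g.det_coe
    rw [Matrix.det_fin_two] at h
    exact_mod_cast h
  have h1 : HasDerivAt (fun w : ℂ => (g 0 0 : ℂ) * w + (g 0 1 : ℂ)) (g 0 0 : ℂ) (z : ℂ) := by
    simpa using ((hasDerivAt_id (z : ℂ)).const_mul (g 0 0 : ℂ)).add_const (g 0 1 : ℂ)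
  have h2 : HasDerivAt (fun w : ℂ => (g 1 0 : ℂ) * w + (g 1 1 : ℂ)) (g 1 0 : ℂ) (z : ℂ) := by
    simpa using ((hasDerivAt_id (z : ℂ)).const_mul (g 1 0 : ℂ)).add_const (g 1 1 : ℂ)
  refine (h1.div h2 (cdenom_ne_zero g z)).congr_deriv ?_
  unfold cdenom
  congr 1
  linear_combination hdet

/-- `SL₂(ℝ)` acts on the unit tangent bundle: `g` sends the vector `v` at `z` to its image
`v / (c z + d) ^ 2` at `g • z` under the derivative of `g` at `z`. -/
noncomputable instance : MulAction SL(2, ℝ) UTH where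
  smul g u := ⟨(g • u.1.1, u.1.2 / cdenom g u.1.1 ^ 2), by
    have h := UpperHalfPlane.im_smul_eq_div_normSq (g : GL (Fin 2) ℝ) u.1.1
    have h' : (g • u.1.1).im = u.1.1.im / Complex.normSq (cdenom g u.1.1) := by
      refine h.trans ?_
      simp [cdenom, UpperHalfPlane.denom]
    rw [h', norm_div, norm_pow, u.2, Complex.sq_norm]⟩
  one_smul u := by
    refine Subtype.ext (Prod.ext (one_smul _ _) ?_)
    change u.1.2 / cdenom 1 u.1.1 ^ 2 = u.1.2
    simp [cdenom]
  mul_smul g h u := by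
    refine Subtype.ext (Prod.ext (mul_smul _ _ _) ?_)
    change u.1.2 / cdenom (g * h) u.1.1 ^ 2
      = u.1.2 / cdenom h u.1.1 ^ 2 / cdenom g (h • u.1.1) ^ 2
    rw [cdenom_mul, mul_pow, div_div, mul_comm]

theorem center_smul (g : SL(2, ℝ)) (hg : g ∈ Subgroup.center SL(2, ℝ)) (u : UTH) :
    g • u = u := by
  obtain ⟨r, hr, hg'⟩ := Matrix.SpecialLinearGroup.mem_center_iff.1 hg
  have h00 : g 0 0 = r := by rw [← hg']; simp
  have h01 : g 0 1 = 0 := by rw [← hg']; simp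
  have h10 : g 1 0 = 0 := by rw [← hg']; simp
  have h11 : g 1 1 = r := by rw [← hg']; simp
  have hr2 : (r : ℂ) ^ 2 = 1 := by
    simp only [Fintype.card_fin] at hr
    exact_mod_cast hr
  have hr0 : (r : ℂ) ≠ 0 := by
    intro h0
    simp [h0] at hr2
  refine Subtype.ext (Prod.ext ?_ ?_)
  · change g • u.1.1 = u.1.1
    apply UpperHalfPlane.ext
    rw [UpperHalfPlane.coe_specialLinearGroup_apply]
    simp [h00, h01, h10, h11, hr0]
  · change u.1.2 / cdenom g u.1.1 ^ 2 = u.1.2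
    simp [cdenom, h10, h11, hr2]

/-- The action of `PSL₂(ℝ)`, the group of orientation-preserving isometries, on the unit tangent
bundle, as a homomorphism to the permutations. -/
noncomputable def pslPerm : PSL(2, ℝ) →* Equiv.Perm UTH :=
  QuotientGroup.lift (Subgroup.center SL(2, ℝ)) (MulAction.toPermHom SL(2, ℝ) UTH)
    fun g hg => Equiv.ext fun u => center_smul g hg u

/-- The action of `PSL₂(ℝ)` on the unit tangent bundle by isometries. -/
noncomputable instance : MulAction PSL(2, ℝ) UTH := MulAction.compHom UTH pslPerm

/-! ### The twist -/

/-- The path `V` of unit tangent vectors lies in the homotopy class `α`: under the identification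
`g ↦ g • V 0` of `PSL₂(ℝ)` with the unit tangent bundle, `V` is a path in `PSL₂(ℝ)` that starts
at `1` and represents `α`. -/
def LiesInClass (V : C(I, UTH)) (α : PSLTilde) : Prop :=
  ∃ γ : BasedPath PSL(2, ℝ) 1, UniversalCover.mk γ = α ∧ ∀ t, V t = γ.1 t • V 0

/-- `c : [0,1] → ℍ` is a geodesic of constant (possibly zero) speed for the hyperbolic distance. -/
def IsConstSpeedGeodesic (c : I → ℍ) : Prop :=
  ∀ s t : I, dist (c s) (c t) = |(s : ℝ) - t| * dist (c 0) (c 1)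

/-- `e t` is the velocity vector of `c` at time `t`, rescaled to a hyperbolic unit vector. Along a
constant curve, which has no direction, `e` is any constant unit vector. -/
def IsUnitVelocity (c : I → ℍ) (e : I → ℂ) : Prop :=
  (∀ t, ‖e t‖ = (c t).im) ∧
    ((∀ t : I, ∃ r : ℝ, 0 < r ∧
        HasDerivWithinAt (fun s : ℝ => (c (Set.projIcc 0 1 zero_le_one s) : ℂ)) (r * e t)
          (Set.Icc 0 1) (t : ℝ)) ∨
      ∀ t, c t = c 0 ∧ e t = e 0)

/-- `τ` is the twist of the unit tangent vector field `V` along its base curve `c`: for a continuous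
choice `θ t` of the angle, measured anticlockwise, from the unit velocity vector of `c` to `V t`,
it is `θ 1 - θ 0`. -/
def IsFieldTwist (V : C(I, UTH)) (τ : ℝ) : Prop :=
  ∃ (e : I → ℂ) (θ : C(I, ℝ)), IsUnitVelocity (fun t => (V t).base) e ∧
    (∀ t, (V t).vec = Complex.exp (θ t * Complex.I) * e t) ∧ τ = θ 1 - θ 0

/-- `τ` is the twist of `α` at `y`: the twist of a unit tangent vector field that lies in the
homotopy class `α` and along a constant speed geodesic that starts at `y` (and so ends at the image
of `y` under the isometry that `α` covers). -/
def IsTwist (α : PSLTilde) (y : ℍ) (τ : ℝ) : Prop :=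
  ∃ V : C(I, UTH), (V 0).base = y ∧ LiesInClass V α ∧
    IsConstSpeedGeodesic (fun t => (V t).base) ∧ IsFieldTwist V τ

open Classical in
/-- `Twist(α, y)`, the number `τ` with `IsTwist α y τ`. -/
noncomputable def twist (α : PSLTilde) (y : ℍ) : ℝ :=
  if h : ∃ τ, IsTwist α y τ then h.choose else 0

end HypTwist

namespace HypTwist

/-! ### Paths in simply connected spaces -/

/-! Write g in `SL(2, ℝ)` as P R, with P the positive definite matrix sending i to z = g i and R the
rotation by φ. Since P R = R (R⁻¹ P R), R is also the rotation part in the decomposition R S, so in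
the coordinates (z, φ) Milnor's Θ is the final value of φ along a lifted path starting at (i, 0)
(`milnorTheta_polarClass`).

The derivative of g at i is exp(2iφ) `transport z`: R has derivative exp(2iφ) at i, which is the
source of the factor 2, and P has derivative `transport z` (`vec_polarMap_smul`,
`transport_eq_cdenom`). The unit velocity of a geodesic from i is also the transport of its initial
value (`IsUnitVelocity.eq_transport`), because in the disc model the geodesic is a radius. So the
angle from the velocity to a field in the given class is 2φ plus a constant, and its increment is 2Θ
for every choice of field, velocity and angle.

For existence, ℍ × ℝ is simply connected, so a path may be replaced by any path with the same
endpoints, in particular by one whose ℍ-component is a geodesic. -/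

theorem UniversalCover.mk_eq_mk_of_simplyConnected {X : Type*} [TopologicalSpace X]
    [SimplyConnectedSpace X] {x₀ : X} {γ γ' : BasedPath X x₀} (h : γ.1 1 = γ'.1 1) :
    UniversalCover.mk γ = UniversalCover.mk γ' :=
  Quotient.sound (SimplyConnectedSpace.paths_homotopic
    (⟨γ.1, γ.2, rfl⟩ : Path x₀ (γ.1 1)) ⟨γ'.1, γ'.2, h.symm⟩)

/-! ### The Cayley transform -/

/-- The Cayley transform of the upper half plane to the unit disc. -/
noncomputable def cayley (z : ℂ) : ℂ := (z - Complex.I) / (z + Complex.I)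

theorem add_I_ne_zero (z : ℍ) : (z : ℂ) + Complex.I ≠ 0 := by
  intro h
  have h1 := congrArg Complex.im h
  have h2 := z.im_pos
  simp at h1
  linarith

theorem cosh_half_dist_I (z : ℍ) :
    Real.cosh (dist z UpperHalfPlane.I / 2) = ‖(z : ℂ) + Complex.I‖ / (2 * √z.im) := by
  rw [UpperHalfPlane.cosh_half_dist]
  simp [Complex.dist_eq]

theorem norm_cayley (z : ℍ) : ‖cayley z‖ = Real.tanh (dist z UpperHalfPlane.I / 2) := by
  rw [UpperHalfPlane.tanh_half_dist]
  simp [Complex.dist_eq, cayley]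

/-- The difference of the two images is 2i(z - w)/((z + i)(w + i)), and each factor matches a
half-distance formula. Together with the subtraction formula for sinh, this yields equality in the
triangle inequality in the disc for points of a geodesic from i. -/
theorem norm_cayley_sub (z w : ℍ) :
    ‖cayley z - cayley w‖ * (Real.cosh (dist z UpperHalfPlane.I / 2) *
      Real.cosh (dist w UpperHalfPlane.I / 2)) = Real.sinh (dist z w / 2) := by
  have hz := add_I_ne_zero z
  have hw := add_I_ne_zero w
  have e : cayley z - cayley w = 2 * Complex.I * (z - w) / ((z + Complex.I) * (w + Complex.I)) := by
    unfold cayley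
    field_simp
    ring
  have hz' := norm_ne_zero_iff.2 hz
  have hw' := norm_ne_zero_iff.2 hw
  have h1 := (Real.sqrt_pos.2 z.im_pos).ne'
  have h2 := (Real.sqrt_pos.2 w.im_pos).ne'
  rw [e, cosh_half_dist_I, cosh_half_dist_I, UpperHalfPlane.sinh_half_dist, Complex.dist_eq,
    Real.sqrt_mul z.im_pos.le]
  simp only [norm_div, norm_mul, Complex.norm_I, Complex.norm_ofNat]
  field_simp

theorem cayley_injective {z w : ℍ} (h : cayley z = cayley w) : z = w := by
  have := norm_cayley_sub z w
  rw [h, sub_self, norm_zero, zero_mul, eq_comm, Real.sinh_eq_zero] at this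
  exact dist_eq_zero.1 (by linarith)

/-- In the disc model, a constant speed geodesic that starts at the centre runs along a radius. -/
theorem exists_cayley_geodesic {c : I → ℍ} (hc : IsConstSpeedGeodesic c)
    (h0 : c 0 = UpperHalfPlane.I) :
    ∃ u : ℂ, ∀ t : I, cayley (c t) = (Real.tanh ((t : ℝ) * (dist (c 0) (c 1) / 2)) : ℂ) * u := by
  set L := dist (c 0) (c 1) with hL
  have hd (t : I) : dist (c t) UpperHalfPlane.I = t * L := by
    rw [← h0, hc t 0]
    simp [abs_of_nonneg t.2.1, ← hL]
  have hn (t : I) : ‖cayley (c t)‖ = Real.tanh ((t : ℝ) * (L / 2)) := by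
    rw [norm_cayley, hd, mul_div_assoc]
  -- In a strictly convex space, ‖x - y‖ = |‖x‖ - ‖y‖| forces x and y onto one ray. Here the
  -- equality is sinh(a - b)/(cosh a cosh b) = tanh a - tanh b.
  have hray (t : I) : SameRay ℝ (cayley (c 1)) (cayley (c t)) := by
    rw [sameRay_iff_norm_sub, hn, hn]
    have h := norm_cayley_sub (c 1) (c t)
    have ht : 0 ≤ 1 - (t : ℝ) := sub_nonneg.2 t.2.2
    rw [hd, hd, hc 1 t, ← hL, Set.Icc.coe_one, abs_of_nonneg ht] at h
    have e : (1 - (t : ℝ)) * L / 2 = 1 * (L / 2) - t * (L / 2) := by ring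
    rw [e, Real.sinh_sub, mul_div_assoc, mul_div_assoc] at h
    have c1 := Real.cosh_pos (1 * (L / 2))
    have c2 := Real.cosh_pos ((t : ℝ) * (L / 2))
    have key : ‖cayley (c 1) - cayley (c t)‖
        = Real.tanh (1 * (L / 2)) - Real.tanh ((t : ℝ) * (L / 2)) := by
      rw [Real.tanh_eq_sinh_div_cosh, Real.tanh_eq_sinh_div_cosh]
      generalize 1 * (L / 2) = a at h c1 ⊢
      generalize (t : ℝ) * (L / 2) = b at h c2 ⊢
      field_simp
      linear_combination h
    rw [Set.Icc.coe_one, ← key, abs_of_nonneg (norm_nonneg _)]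
  rcases eq_or_ne L 0 with hL0 | hL0
  · refine ⟨0, fun t => ?_⟩
    rw [mul_zero, ← norm_eq_zero, hn, hL0]
    simp
  · have hq : Real.tanh (L / 2) ≠ 0 := by
      rw [Real.tanh_eq_sinh_div_cosh]
      have := Real.cosh_pos (L / 2)
      have : Real.sinh (L / 2) ≠ 0 := by simpa [Real.sinh_eq_zero] using hL0
      positivity
    refine ⟨cayley (c 1) / (Real.tanh (L / 2) : ℂ), fun t => ?_⟩
    have h := (hray t).norm_smul_eq
    rw [hn, hn, Set.Icc.coe_one, one_mul, Complex.real_smul, Complex.real_smul] at h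
    have hq' : ((Real.tanh (L / 2) : ℝ) : ℂ) ≠ 0 := Complex.ofReal_ne_zero.2 hq
    rw [← mul_div_assoc, eq_div_iff hq', mul_comm]
    exact h

/-- The derivative at `i` of the positive definite isometry that sends `i` to `z`, that is,
the factor by which parallel transport along the geodesic from `i` to `z` acts on vectors. -/
noncomputable def transport (z : ℍ) : ℂ :=
  -((z.im / ‖(z : ℂ) + Complex.I‖ ^ 2 : ℝ) * ((z : ℂ) + Complex.I) ^ 2)

theorem transport_I : transport UpperHalfPlane.I = 1 := by
  have : (Complex.I + Complex.I) = 2 * Complex.I := by ring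
  simp only [transport, UpperHalfPlane.coe_I, UpperHalfPlane.I_im, this, mul_pow, Complex.I_sq,
    norm_mul, Complex.norm_I, Complex.norm_ofNat]
  norm_num

theorem hasDerivAt_cayley (z : ℍ) :
    HasDerivAt cayley (2 * Complex.I / ((z : ℂ) + Complex.I) ^ 2) z := by
  refine (((hasDerivAt_id (z : ℂ)).sub_const Complex.I).div
    ((hasDerivAt_id (z : ℂ)).add_const Complex.I) (add_I_ne_zero z)).congr_deriv ?_
  simp only [id]
  congr 1
  ring

/-- The unit velocity of a geodesic from `i` is parallel along the geodesic. -/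
theorem IsUnitVelocity.eq_transport {c : I → ℍ} {e : I → ℂ} (hc : IsConstSpeedGeodesic c)
    (h0 : c 0 = UpperHalfPlane.I) (he : IsUnitVelocity c e) (t : I) :
    e t = transport (c t) * e 0 := by
  obtain ⟨hn, hd | hconst⟩ := he
  · obtain ⟨u, hu⟩ := exists_cayley_geodesic hc h0
    set a := dist (c 0) (c 1) / 2
    -- The image in the disc moves in the fixed direction u; dividing by the derivative 2i/(z + i)²
    -- of the Cayley transform gives the direction of e t.
    have key (t : I) : ∃ m : ℝ, 0 < m ∧
        e t = m * ((c t : ℂ) + Complex.I) ^ 2 * (a * u / (2 * Complex.I)) := by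
      obtain ⟨r, hr, hd⟩ := hd t
      have hproj : Set.projIcc (0 : ℝ) 1 zero_le_one t = t := Set.projIcc_val _ t
      have h1 : HasDerivWithinAt
          (fun s : ℝ => cayley (c (Set.projIcc 0 1 zero_le_one s)))
          (2 * Complex.I / ((c t : ℂ) + Complex.I) ^ 2 * (r * e t)) (Set.Icc 0 1) (t : ℝ) := by
        have hc' := hasDerivAt_cayley (c t)
        rw [← hproj] at hc'
        have := hc'.comp_hasDerivWithinAt (t : ℝ) hd
        rwa [hproj] at this
      have hch := Real.cosh_pos ((t : ℝ) * a)
      have h2 : HasDerivAt (fun s : ℝ => ((Real.tanh (s * a) : ℝ) : ℂ) * u)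
          (((a / Real.cosh ((t : ℝ) * a) ^ 2 : ℝ) : ℂ) * u) (t : ℝ) := by
        have hs : HasDerivAt (fun s : ℝ => Real.tanh (s * a))
            (a / Real.cosh ((t : ℝ) * a) ^ 2) (t : ℝ) := by
          have h3 := ((hasDerivAt_id (t : ℝ)).mul_const a).sinh.div
            ((hasDerivAt_id (t : ℝ)).mul_const a).cosh hch.ne'
          simp only [id] at h3
          refine (h3.congr_deriv ?_).congr_of_eventuallyEq
            (Filter.Eventually.of_forall fun s => Real.tanh_eq_sinh_div_cosh _)
          congr 1
          linear_combination a * Real.cosh_sq_sub_sinh_sq ((t : ℝ) * a)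
        exact hs.ofReal_comp.mul_const u
      have h4 := h2.hasDerivWithinAt (s := Set.Icc (0 : ℝ) 1)
      have h5 := h1.congr (f₁ := fun s : ℝ => ((Real.tanh (s * a) : ℝ) : ℂ) * u)
        (fun s hs => by
          rw [hu, Set.projIcc_of_mem zero_le_one hs]) (by rw [hu, hproj])
      have h6 := (uniqueDiffOn_Icc (zero_lt_one (α := ℝ)) t t.2).eq_deriv _ h5 h4
      refine ⟨1 / (r * Real.cosh ((t : ℝ) * a) ^ 2), by positivity, ?_⟩
      have hz := add_I_ne_zero (c t)
      have hr' : (r : ℂ) ≠ 0 := Complex.ofReal_ne_zero.2 hr.ne'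
      have hch' : ((Real.cosh ((t : ℝ) * a) : ℝ) : ℂ) ≠ 0 := Complex.ofReal_ne_zero.2 hch.ne'
      push_cast at h6 hch' ⊢
      field_simp at h6 ⊢
      linear_combination h6
    obtain ⟨m, hm, h⟩ := key t
    obtain ⟨m', hm', h'⟩ := key 0
    rw [h0, UpperHalfPlane.coe_I] at h'
    have hm'' : (m' : ℂ) ≠ 0 := Complex.ofReal_ne_zero.2 hm'.ne'
    -- Eliminate the common constant using its value at time 0, where (i + i)² = -4. The positive
    -- factor that remains is then determined by the norm of e t.
    have h1 : e t = -(((m / (4 * m') : ℝ) : ℂ) * ((c t : ℂ) + Complex.I) ^ 2 * e 0) := by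
      rw [h, h']
      push_cast
      field_simp
      linear_combination ((4 * (m : ℂ) * (c t + Complex.I) ^ 2 * a * u)) * Complex.I_sq
    have h2 := hn t
    have h3 := hn 0
    rw [h0, UpperHalfPlane.I_im] at h3
    rw [h1, norm_neg, norm_mul, norm_mul, h3, mul_one, Complex.norm_real, Real.norm_eq_abs,
      abs_of_pos (by positivity), norm_pow] at h2
    rw [h1, transport, ← h2, mul_div_cancel_right₀ _
      (pow_ne_zero 2 (norm_ne_zero_iff.2 (add_I_ne_zero (c t))))]
    ring
  · rw [(hconst t).1, (hconst t).2, h0, transport_I, one_mul]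

/-! ### Polar coordinates on `SL₂(ℝ)` -/

theorem coe_smul_mul_cdenom (g : SL(2, ℝ)) (z : ℍ) :
    ((g • z : ℍ) : ℂ) * cdenom g z = (g 0 0 : ℂ) * z + (g 0 1 : ℂ) := by
  have hz := UpperHalfPlane.coe_specialLinearGroup_apply g z
  rw [hz]
  exact div_mul_cancel₀ _ (cdenom_ne_zero g z)

/-- The rotation `expSO2 φ` as an element of `SL₂(ℝ)`. -/
noncomputable def rotSL (φ : ℝ) : SL(2, ℝ) :=
  ⟨(expSO2 φ : Matrix (Fin 2) (Fin 2) ℝ), (Matrix.mem_specialOrthogonalGroup_iff.1 (expSO2 φ).2).2⟩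

theorem continuous_rotSL : Continuous rotSL :=
  continuous_induced_rng.2
    (show Continuous fun φ => (expSO2 φ : Matrix (Fin 2) (Fin 2) ℝ) from
      continuous_subtype_val.comp expSO2.continuous)

theorem coe_rotSL_smul (φ : ℝ) (z : ℍ) : ((rotSL φ • z : ℍ) : ℂ) =
    (Complex.cos φ * z + Complex.sin φ) / (-Complex.sin φ * z + Complex.cos φ) := by
  rw [UpperHalfPlane.coe_specialLinearGroup_apply]
  simp [rotSL, expSO2]

/-- The derivative at i is the inverse square of this, exp(2iφ): a rotation matrix of angle φ turns
tangent vectors at i by 2φ. -/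
theorem cdenom_rotSL_I (φ : ℝ) :
    cdenom (rotSL φ) UpperHalfPlane.I = Complex.exp (-(φ * Complex.I)) := by
  rw [← neg_mul, Complex.exp_mul_I]
  simp [cdenom, rotSL, expSO2]
  ring

theorem rotSL_smul_I (φ : ℝ) : rotSL φ • UpperHalfPlane.I = UpperHalfPlane.I := by
  have h := cdenom_ne_zero (rotSL φ) UpperHalfPlane.I
  refine UpperHalfPlane.ext ?_
  rw [coe_rotSL_smul, div_eq_iff (by simpa [cdenom, rotSL, expSO2] using h)]
  simp only [UpperHalfPlane.coe_I]
  linear_combination Complex.sin φ * Complex.I_sq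

/-- Subtracting or adding i to the image of z multiplies z - i or z + i by exp(iφ) or exp(-iφ), over
the same denominator; the quotient picks up exp(2iφ). -/
theorem cayley_rotSL_smul (φ : ℝ) (z : ℍ) :
    cayley ((rotSL φ • z : ℍ) : ℂ) = Complex.exp (2 * φ * Complex.I) * cayley z := by
  have h := cdenom_ne_zero (rotSL φ) z
  simp only [cdenom, rotSL, expSO2] at h
  have h' : -Complex.sin φ * z + Complex.cos φ ≠ 0 := by simpa using h
  have e1 : (Complex.cos φ * z + Complex.sin φ) / (-Complex.sin φ * z + Complex.cos φ) - Complex.I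
      = Complex.exp (φ * Complex.I) * (z - Complex.I) / (-Complex.sin φ * z + Complex.cos φ) := by
    rw [Complex.exp_mul_I, eq_div_iff h', sub_mul, div_mul_cancel₀ _ h']
    linear_combination Complex.sin φ * Complex.I_sq
  have e2 : (Complex.cos φ * z + Complex.sin φ) / (-Complex.sin φ * z + Complex.cos φ) + Complex.I
      = Complex.exp (-φ * Complex.I) * (z + Complex.I) / (-Complex.sin φ * z + Complex.cos φ) := by
    rw [Complex.exp_mul_I, eq_div_iff h', add_mul, div_mul_cancel₀ _ h', Complex.cos_neg,
      Complex.sin_neg]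
    linear_combination Complex.sin φ * Complex.I_sq
  have e3 : Complex.exp (φ * Complex.I)
      = Complex.exp (2 * φ * Complex.I) * Complex.exp (-φ * Complex.I) := by
    rw [← Complex.exp_add]
    congr 1
    ring
  have := Complex.exp_ne_zero (-φ * Complex.I)
  rw [cayley, cayley, coe_rotSL_smul, e1, e2, e3, div_div_div_cancel_right₀ h']
  field_simp

/-- The matrix is the positive square root of M = (1/y) [[x² + y², x], [x, 1]], which is A Aᵀ for
any A in `SL(2, ℝ)` sending i to x + iy. By Cayley–Hamilton the root is (M + 1)/√(tr M + 2), and tr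
M + 2 = N²/y. -/
theorem posSL_det {x y N : ℝ} (hy : 0 < y) (hN : N ^ 2 = x ^ 2 + (1 + y) ^ 2) :
    (!![(x ^ 2 + y ^ 2 + y) / (√y * N), x / (√y * N); x / (√y * N), (1 + y) / (√y * N)]).det
      = 1 := by
  have h1 : √y ≠ 0 := (Real.sqrt_pos.2 hy).ne'
  have h2 : N ≠ 0 := by
    rintro rfl
    nlinarith [sq_nonneg x]
  rw [Matrix.det_fin_two_of]
  field_simp
  rw [Real.sq_sqrt hy.le, hN]
  ring

theorem norm_add_I_sq (z : ℍ) : ‖(z : ℂ) + Complex.I‖ ^ 2 = z.re ^ 2 + (1 + z.im) ^ 2 := by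
  rw [Complex.sq_norm, Complex.normSq_apply]
  simp
  ring

/-- The symmetric positive definite matrix in `SL₂(ℝ)` that sends `i` to `z`. -/
noncomputable def posSL (z : ℍ) : SL(2, ℝ) :=
  ⟨!![(z.re ^ 2 + z.im ^ 2 + z.im) / (√z.im * ‖(z : ℂ) + Complex.I‖),
      z.re / (√z.im * ‖(z : ℂ) + Complex.I‖);
      z.re / (√z.im * ‖(z : ℂ) + Complex.I‖),
      (1 + z.im) / (√z.im * ‖(z : ℂ) + Complex.I‖)],
    posSL_det z.im_pos (norm_add_I_sq z)⟩

theorem sqrt_im_mul_norm_pos (z : ℍ) : 0 < √z.im * ‖(z : ℂ) + Complex.I‖ :=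
  mul_pos (Real.sqrt_pos.2 z.im_pos) (norm_pos_iff.2 (add_I_ne_zero z))

theorem continuous_posSL : Continuous posSL := by
  refine continuous_induced_rng.2 (continuous_matrix fun i j => ?_)
  have h (z : ℍ) := (sqrt_im_mul_norm_pos z).ne'
  have hre : Continuous fun z : ℍ => z.re := UpperHalfPlane.continuous_re
  have him : Continuous fun z : ℍ => z.im := UpperHalfPlane.continuous_im
  have hN : Continuous fun z : ℍ => √z.im * ‖(z : ℂ) + Complex.I‖ :=
    him.sqrt.mul (UpperHalfPlane.continuous_coe.add continuous_const).norm
  fin_cases i <;> fin_cases j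
  · exact (((hre.pow 2).add (him.pow 2)).add him).div hN h
  · exact hre.div hN h
  · exact hre.div hN h
  · exact (continuous_const.add him).div hN h

theorem posSL_smul_I (z : ℍ) : posSL z • UpperHalfPlane.I = z := by
  have hD := (sqrt_im_mul_norm_pos z).ne'
  have h := cdenom_ne_zero (posSL z) UpperHalfPlane.I
  refine UpperHalfPlane.ext (mul_right_cancel₀ h ?_)
  rw [coe_smul_mul_cdenom]
  simp only [cdenom, posSL, Matrix.of_apply, Matrix.cons_val', Matrix.cons_val_zero, Matrix.cons_val_one,
    Matrix.cons_val_fin_one, UpperHalfPlane.coe_I]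
  generalize √z.im * ‖(z : ℂ) + Complex.I‖ = D at hD
  have hD' : (D : ℂ) ≠ 0 := Complex.ofReal_ne_zero.2 hD
  have hz : (z : ℂ) = z.re + z.im * Complex.I := (Complex.re_add_im (z : ℂ)).symm
  rw [hz]
  push_cast
  field_simp
  linear_combination (-(z.re : ℂ) * z.im) * Complex.I_sq

/-- The denominator of `posSL z` at i is i times the conjugate of z + i, divided by √(Im z) ‖z + i‖.
Multiplying by z + i therefore leaves i ‖z + i‖² on top, which is the identity `e`. -/
theorem transport_eq_cdenom (z : ℍ) :
    1 / cdenom (posSL z) UpperHalfPlane.I ^ 2 = transport z := by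
  have h := cdenom_ne_zero (posSL z) UpperHalfPlane.I
  have hN := norm_ne_zero_iff.2 (add_I_ne_zero z)
  have hs := (Real.sqrt_pos.2 z.im_pos).ne'
  have hy : ((√z.im : ℝ) : ℂ) ^ 2 = z.im := by exact_mod_cast Real.sq_sqrt z.im_pos.le
  have hN2 : ((‖(z : ℂ) + Complex.I‖ : ℝ) : ℂ) ^ 2 = (z.re : ℂ) ^ 2 + (1 + z.im) ^ 2 := by
    exact_mod_cast norm_add_I_sq z
  have hN' : ((‖(z : ℂ) + Complex.I‖ : ℝ) : ℂ) ≠ 0 := Complex.ofReal_ne_zero.2 hN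
  have hs' : ((√z.im : ℝ) : ℂ) ≠ 0 := Complex.ofReal_ne_zero.2 hs
  have hz : (z : ℂ) = z.re + z.im * Complex.I := (Complex.re_add_im (z : ℂ)).symm
  have e : ((z : ℂ) + Complex.I) * (z.re * Complex.I + (1 + z.im))
      = Complex.I * (‖(z : ℂ) + Complex.I‖ : ℝ) ^ 2 := by
    rw [hN2, hz]
    linear_combination ((z.re : ℂ) * (1 + z.im)) * Complex.I_sq
  have hd : cdenom (posSL z) UpperHalfPlane.I =
      (z.re * Complex.I + (1 + z.im)) / ((√z.im : ℝ) * (‖(z : ℂ) + Complex.I‖ : ℝ)) := by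
    simp only [cdenom, posSL, Matrix.of_apply, Matrix.cons_val', Matrix.cons_val_zero,
      Matrix.cons_val_one, Matrix.cons_val_fin_one, UpperHalfPlane.coe_I]
    push_cast
    field_simp
  rw [div_eq_iff (pow_ne_zero 2 h), transport, hd, div_pow, mul_pow, hy, neg_mul, Complex.ofReal_div,
    Complex.ofReal_pow]
  have hy' : (z.im : ℂ) ≠ 0 := Complex.ofReal_ne_zero.2 z.im_pos.ne'
  generalize ((‖(z : ℂ) + Complex.I‖ : ℝ) : ℂ) = N at *
  rw [eq_neg_iff_add_eq_zero]
  field_simp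
  linear_combination (((z : ℂ) + Complex.I) * (z.re * Complex.I + (1 + z.im)) + Complex.I * N ^ 2) * e
    + N ^ 4 * Complex.I_sq

theorem posDef_posSL (z : ℍ) : (posSL z : Matrix (Fin 2) (Fin 2) ℝ).PosDef := by
  have hD := sqrt_im_mul_norm_pos z
  have hy := z.im_pos
  refine Matrix.PosDef.of_dotProduct_mulVec_pos ?_ fun v hv => ?_
  · ext i j
    fin_cases i <;> fin_cases j <;> simp [posSL]
  · have hv' : 0 < z.im * (v 0) ^ 2 + (v 1) ^ 2 := by
      by_cases h1 : v 1 = 0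
      · have h0 : v 0 ≠ 0 := fun h0 => hv (by ext i; fin_cases i <;> simp [h0, h1])
        positivity
      · positivity
    simp only [posSL, star_trivial, dotProduct, Matrix.mulVec, Fin.sum_univ_two, Matrix.of_apply,
        Matrix.cons_val_zero, Matrix.cons_val_one, Matrix.cons_val', Matrix.cons_val_fin_one]
    generalize √z.im * ‖(z : ℂ) + Complex.I‖ = D at hD
    have e : v 0 * ((z.re ^ 2 + z.im ^ 2 + z.im) / D * v 0 + z.re / D * v 1) +
        v 1 * (z.re / D * v 0 + (1 + z.im) / D * v 1) =
        ((z.im * (v 0) ^ 2 + (v 1) ^ 2) + ((z.re * v 0 + v 1) ^ 2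
          + z.im ^ 2 * v 0 ^ 2 + z.im * v 1 ^ 2 - v 1 ^ 2)) / D := by
      field_simp
      ring
    rw [e]
    refine div_pos ?_ hD
    nlinarith [mul_nonneg hy.le (sq_nonneg (v 1)), sq_nonneg (z.im * v 0),
      sq_nonneg (z.re * v 0 + v 1), sq_nonneg (v 1)]

/-- The rotation part of a product `P R` of a symmetric positive definite matrix and a rotation. -/
theorem polarRotation_eq_of_eq_mul {A : SL(2, ℝ)} {P : Matrix (Fin 2) (Fin 2) ℝ} {R : SO2}
    (hP : P.PosDef) (h : (A : Matrix (Fin 2) (Fin 2) ℝ) = P * (R : Matrix (Fin 2) (Fin 2) ℝ)) :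
    polarRotation A = R := by
  have hR : R.1 * star R.1 = 1 := (Matrix.mem_orthogonalGroup_iff (Fin 2) ℝ).1
    (Matrix.mem_specialOrthogonalGroup_iff.1 R.2).1
  have hR' : star R.1 * R.1 = 1 := (Matrix.mem_orthogonalGroup_iff' (Fin 2) ℝ).1
    (Matrix.mem_specialOrthogonalGroup_iff.1 R.2).1
  -- P R = R (R⁻¹ P R), and conjugation by R preserves positive definiteness.
  refine ((existsUnique_polar A).choose_spec.2 R ⟨star R.1 * P * R.1, ?_, ?_⟩).symm
  · refine hP.conjTranspose_mul_mul_same (Function.LeftInverse.injective (g := (star R.1).mulVec) ?_)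
    intro v
    rw [Matrix.mulVec_mulVec, hR', Matrix.one_mulVec]
  · rw [h, ← mul_assoc, ← mul_assoc, hR, one_mul]

theorem polarRotation_posSL_mul_rotSL (z : ℍ) (φ : ℝ) :
    polarRotation (posSL z * rotSL φ) = expSO2 φ :=
  polarRotation_eq_of_eq_mul (posDef_posSL z) rfl

theorem posSL_mul_rotSL_smul_I (z : ℍ) (φ : ℝ) :
    (posSL z * rotSL φ) • UpperHalfPlane.I = z := by
  rw [mul_smul, rotSL_smul_I, posSL_smul_I]

/-- Comparing real and imaginary parts in ai + b = i(ci + d) gives a = d and b = -c; the determinant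
condition then makes the matrix a rotation. -/
theorem mem_specialOrthogonalGroup_of_smul_I {h : SL(2, ℝ)}
    (hI : h • UpperHalfPlane.I = UpperHalfPlane.I) :
    (h : Matrix (Fin 2) (Fin 2) ℝ) ∈ Matrix.specialOrthogonalGroup (Fin 2) ℝ := by
  have h1 := coe_smul_mul_cdenom h UpperHalfPlane.I
  rw [hI, cdenom] at h1
  have hre := congrArg Complex.re h1
  have him := congrArg Complex.im h1
  simp at hre him
  have hdet := h.det_coe
  rw [Matrix.det_fin_two] at hdet
  rw [Matrix.mem_specialOrthogonalGroup_fin_two_iff]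
  refine ⟨him.symm, by linarith, ?_⟩
  rw [← him, ← hre] at hdet
  rw [← hre, ← him]
  linear_combination hdet

/-- Polar coordinates: `g` is determined by the image of `i` and its rotation part. -/
theorem posSL_mul_rotSL_eq {g : SL(2, ℝ)} {φ : ℝ} (h : expSO2 φ = polarRotation g) :
    posSL (g • UpperHalfPlane.I) * rotSL φ = g := by
  set P := posSL (g • UpperHalfPlane.I) with hP
  have hI : (P⁻¹ * g) • UpperHalfPlane.I = UpperHalfPlane.I := by
    rw [mul_smul, inv_smul_eq_iff, posSL_smul_I]
  have hg : g = P * (P⁻¹ * g) := by group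
  have := polarRotation_eq_of_eq_mul (R := ⟨_, mem_specialOrthogonalGroup_of_smul_I hI⟩)
    (posDef_posSL (g • UpperHalfPlane.I)) (congrArg Subtype.val hg)
  rw [← h] at this
  have h1 := congrArg Subtype.val this
  have h2 : rotSL φ = P⁻¹ * g := Subtype.ext h1
  rw [h2, mul_inv_cancel_left]

/-! ### Polar coordinates on the universal cover -/

/-- The universal covering `ℍ × ℝ → SL₂(ℝ)` by polar coordinates. -/
noncomputable def polarMap : C(ℍ × ℝ, SL(2, ℝ)) :=
  ⟨fun p => posSL p.1 * rotSL p.2,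
    (continuous_posSL.comp continuous_fst).mul (continuous_rotSL.comp continuous_snd)⟩

theorem polarMap_base : polarMap (UpperHalfPlane.I, 0) = 1 := by
  have h : expSO2 0 = polarRotation 1 := by rw [expSO2_zero, polarRotation_one]
  have h1 := posSL_mul_rotSL_eq h
  rwa [one_smul] at h1

theorem polarMap_smul_I (p : ℍ × ℝ) : polarMap p • UpperHalfPlane.I = p.1 :=
  posSL_mul_rotSL_smul_I p.1 p.2

theorem polarRotation_polarMap (p : ℍ × ℝ) : polarRotation (polarMap p) = expSO2 p.2 :=
  polarRotation_posSL_mul_rotSL p.1 p.2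

theorem base_smul (g : SL(2, ℝ)) (u : UTH) : (g • u).base = g • u.base := rfl

theorem vec_smul (g : SL(2, ℝ)) (u : UTH) : (g • u).vec = u.vec / cdenom g u.base ^ 2 := rfl

theorem toPSL_smul (g : SL(2, ℝ)) (u : UTH) : toPSL g • u = g • u := rfl

/-- Chain rule for P R at i: R fixes i and contributes exp(2iφ), and P contributes `transport`. -/
theorem vec_polarMap_smul (p : ℍ × ℝ) {u : UTH} (hu : u.base = UpperHalfPlane.I) :
    (polarMap p • u).vec = Complex.exp ((2 * p.2 : ℝ) * Complex.I) * (transport p.1 * u.vec) := by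
  have h1 : Complex.exp (((2 * p.2 : ℝ) : ℂ) * Complex.I) * Complex.exp (-(p.2 * Complex.I)) ^ 2
      = 1 := by
    rw [← Complex.exp_nat_mul, ← Complex.exp_add]
    push_cast
    ring_nf
    exact Complex.exp_zero
  have h2 := cdenom_ne_zero (posSL p.1) UpperHalfPlane.I
  have h3 := Complex.exp_ne_zero (-(p.2 * Complex.I))
  have h4 : cdenom (polarMap p) UpperHalfPlane.I
      = cdenom (posSL p.1) UpperHalfPlane.I * Complex.exp (-(p.2 * Complex.I)) := by
    rw [← cdenom_rotSL_I]
    conv_rhs => rw [← rotSL_smul_I p.2]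
    exact (cdenom_mul _ _ _).trans (by rw [rotSL_smul_I])
  rw [vec_smul, hu, h4, ← transport_eq_cdenom, mul_pow]
  generalize Complex.exp (-(p.2 * Complex.I)) = E at *
  field_simp
  linear_combination -u.vec * h1

/-- Every path in `SL₂(ℝ)` that starts at `1` lifts to polar coordinates. -/
theorem exists_polarMap_lift (g : BasedPath SL(2, ℝ) 1) :
    ∃ ψ : BasedPath (ℍ × ℝ) (UpperHalfPlane.I, 0), ∀ t, polarMap (ψ.1 t) = g.1 t := by
  have h0 : (ContinuousMap.comp ⟨polarRotation, continuous_polarRotation⟩ g.1) 0 = expSO2 0 := by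
    simp [g.2, polarRotation_one, expSO2_zero]
  -- Only the angle has to be lifted; the ℍ-coordinate must be the image of i.
  let φ := isCoveringMap_expSO2.liftPath _ 0 h0
  have hφ (t : I) : expSO2 (φ t) = polarRotation (g.1 t) :=
    congrFun (isCoveringMap_expSO2.liftPath_lifts _ 0 h0) t
  have hφ0 : φ 0 = 0 := isCoveringMap_expSO2.liftPath_zero _ 0 h0
  refine ⟨⟨⟨fun t => (g.1 t • UpperHalfPlane.I, φ t), ?_⟩, ?_⟩, fun t => ?_⟩
  · exact (g.1.continuous.smul continuous_const).prodMk φ.continuous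
  · simp [g.2, hφ0]
  · exact posSL_mul_rotSL_eq (hφ t)

/-- The element of the universal cover of `PSL₂(ℝ)` given by a path in polar coordinates. -/
noncomputable def polarClass (ψ : BasedPath (ℍ × ℝ) (UpperHalfPlane.I, 0)) : PSLTilde :=
  tildeEquiv (UniversalCover.map polarMap polarMap_base (UniversalCover.mk ψ))

theorem polarClass_surjective : Function.Surjective polarClass := by
  intro α
  obtain ⟨β, rfl⟩ := tildeEquiv.surjective α
  induction β using Quotient.inductionOn with | _ g
  obtain ⟨ψ, hψ⟩ := exists_polarMap_lift g
  refine ⟨ψ, congrArg tildeEquiv ?_⟩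
  exact congrArg UniversalCover.mk (Subtype.ext (ContinuousMap.ext hψ))

/-- Simple connectedness of ℍ × ℝ makes the endpoint the only invariant, so a path can be exchanged
for one lying over a geodesic. -/
theorem polarClass_eq {ψ ψ' : BasedPath (ℍ × ℝ) (UpperHalfPlane.I, 0)} (h : ψ.1 1 = ψ'.1 1) :
    polarClass ψ = polarClass ψ' := by
  rw [polarClass, polarClass, UniversalCover.mk_eq_mk_of_simplyConnected h]

/-- The rotation part along the path is `expSO2` of the second coordinate, and in ℝ that coordinate
is homotopic to the linear path used in `expTilde`. -/
theorem milnorTheta_polarClass (ψ : BasedPath (ℍ × ℝ) (UpperHalfPlane.I, 0)) :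
    milnorTheta (polarClass ψ) = (ψ.1 1).2 := by
  rw [milnorTheta, polarClass, Equiv.symm_apply_apply, Equiv.symm_apply_eq]
  let a : BasedPath ℝ 0 := ⟨ContinuousMap.snd.comp ψ.1, by simp [ψ.2]⟩
  let b : BasedPath ℝ 0 := ⟨⟨fun t : I => (t : ℝ) * (ψ.1 1).2, by fun_prop⟩, by simp⟩
  have hab : UniversalCover.mk a = UniversalCover.mk b :=
    UniversalCover.mk_eq_mk_of_simplyConnected (by simp [a, b])
  refine Eq.trans ?_ (congrArg (UniversalCover.map expSO2 expSO2_zero) hab)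
  exact congrArg UniversalCover.mk
    (Subtype.ext (ContinuousMap.ext fun t => polarRotation_polarMap (ψ.1 t)))

theorem liesInClass_polarClass {V : C(I, UTH)} {ψ : BasedPath (ℍ × ℝ) (UpperHalfPlane.I, 0)}
    (h : ∀ t, V t = polarMap (ψ.1 t) • V 0) : LiesInClass V (polarClass ψ) :=
  ⟨⟨toPSL.comp (polarMap.comp ψ.1), by simp [ψ.2, polarMap_base]; rfl⟩, rfl, h⟩

/-- Lift from `PSL(2, ℝ)` to `SL(2, ℝ)` and then to polar coordinates. Neither lift changes the
action on unit tangent vectors. -/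
theorem LiesInClass.exists_polarClass {V : C(I, UTH)} {α : PSLTilde} (h : LiesInClass V α) :
    ∃ ψ, polarClass ψ = α ∧ ∀ t, V t = polarMap (ψ.1 t) • V 0 := by
  obtain ⟨γ, rfl, hV⟩ := h
  have h0 : γ.1 0 = toPSL 1 := γ.2
  let g : BasedPath SL(2, ℝ) 1 := ⟨isCoveringMap_toPSL.liftPath γ.1 1 h0,
    isCoveringMap_toPSL.liftPath_zero _ _ h0⟩
  have hg (t : I) : toPSL (g.1 t) = γ.1 t :=
    congrFun (isCoveringMap_toPSL.liftPath_lifts γ.1 1 h0) t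
  obtain ⟨ψ, hψ⟩ := exists_polarMap_lift g
  refine ⟨ψ, congrArg UniversalCover.mk (Subtype.ext (ContinuousMap.ext fun t => ?_)), fun t => ?_⟩
  · exact (congrArg toPSL (hψ t)).trans (hg t)
  · rw [hψ, ← toPSL_smul, hg]
    exact hV t

/-! ### Existence of geodesics -/

/-- Every point is the end of a constant speed geodesic from `i`, which has a unit velocity. -/
theorem exists_geodesic (z : ℍ) : ∃ (c : C(I, ℍ)) (e : I → ℂ), c 0 = UpperHalfPlane.I ∧ c 1 = z ∧
    IsConstSpeedGeodesic c ∧ IsUnitVelocity c e := by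
  let L := dist z UpperHalfPlane.I
  have hL : 0 ≤ L := dist_nonneg
  -- Half the argument, since `rotSL φ` turns the disc by 2φ. The geodesic is the imaginary axis,
  -- which is the real diameter of the disc, turned towards z.
  let k := rotSL ((cayley z).arg / 2)
  let y (s : ℝ) : ℍ := ⟨Complex.I * Real.exp (s * L), by
    simpa [-Complex.ofReal_exp] using Real.exp_pos (s * L)⟩
  have hyim (s : ℝ) : (y s).im = Real.exp (s * L) := by
    change (Complex.I * (Real.exp (s * L) : ℂ)).im = _
    simp [-Complex.ofReal_exp]
  have hyre (s : ℝ) : (y s).re = 0 := by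
    change (Complex.I * (Real.exp (s * L) : ℂ)).re = _
    simp [-Complex.ofReal_exp]
  have hyd (s t : ℝ) : dist (y s) (y t) = |s - t| * L := by
    rw [UpperHalfPlane.dist_of_re_eq (by rw [hyre, hyre]), hyim, hyim, Real.log_exp, Real.log_exp,
      Real.dist_eq, ← sub_mul, abs_mul, abs_of_nonneg hL]
  have hy0 : y 0 = UpperHalfPlane.I := UpperHalfPlane.ext (by simp [y])
  have hyc : Continuous y := by
    refine UpperHalfPlane.isEmbedding_coe.continuous_iff.2 ?_
    change Continuous fun s : ℝ => Complex.I * (Real.exp (s * L) : ℂ)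
    fun_prop
  have hgeo : IsConstSpeedGeodesic fun t : I => k • y t := by
    intro s t
    simp only [dist_smul, hyd]
    simp
  have h0 : k • y 0 = UpperHalfPlane.I := by rw [hy0, rotSL_smul_I]
  refine ⟨⟨fun t => k • y t, (hyc.comp continuous_subtype_val).const_smul k⟩,
    fun t => (y t : ℂ) / cdenom k (y t) ^ 2, ?_, ?_, hgeo, ?_, ?_⟩
  · simpa using h0
  · refine cayley_injective ?_
    have h1 : cayley (y 1) = (‖cayley z‖ : ℝ) := by
      have e1 : dist (y 1) UpperHalfPlane.I = L := by rw [← hy0, hyd]; simp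
      have e2 : ‖cayley (y 1)‖ = ‖cayley z‖ := by rw [norm_cayley, norm_cayley, e1]
      have e3 : cayley (y 1) = ((Real.exp L - 1) / (Real.exp L + 1) : ℝ) := by
        have : ((y 1 : ℍ) : ℂ) = Complex.I * (Real.exp L : ℂ) := by simp [y]
        rw [cayley, this]
        have hpos : ((Real.exp L : ℝ) : ℂ) + 1 ≠ 0 := by
          exact_mod_cast (by positivity : Real.exp L + 1 ≠ 0)
        rw [Complex.ofReal_div, Complex.ofReal_sub, Complex.ofReal_add, Complex.ofReal_one,
          ← mul_sub_one, ← mul_add_one, mul_div_mul_left _ _ Complex.I_ne_zero]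
      rw [← e2, e3, Complex.norm_real, Real.norm_of_nonneg]
      exact div_nonneg (by linarith [Real.one_le_exp hL]) (by positivity)
    change cayley ((k • y (1 : I) : ℍ) : ℂ) = cayley z
    rw [Set.Icc.coe_one, cayley_rotSL_smul, h1]
    conv_rhs => rw [← Complex.norm_mul_exp_arg_mul_I (cayley z)]
    rw [mul_comm]
    push_cast
    ring_nf
  · intro t
    change ‖(y t : ℂ) / cdenom k (y t) ^ 2‖ = (k • y t).im
    let u : UTH := ⟨(y t, (y t : ℂ)), by
      change ‖Complex.I * (Real.exp (t * L) : ℂ)‖ = _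
      rw [hyim, norm_mul, Complex.norm_I, one_mul, Complex.norm_real, Real.norm_eq_abs,
        Real.abs_exp]⟩
    exact (k • u).2
  -- At speed 0 no positive r relates the derivative to a unit vector, so the constant alternative
  -- of `IsUnitVelocity` is needed.
  · rcases hL.eq_or_lt with hL0 | hL0
    · right
      have hy1 (s : ℝ) : y s = UpperHalfPlane.I := by
        rw [← hy0, ← dist_eq_zero, hyd, ← hL0, mul_zero]
      intro t
      constructor
      · change k • y t = k • y (0 : I)
        rw [hy1, hy1]
      · simp only [hy1]
    · left
      intro t
      refine ⟨L, hL0, ?_⟩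
      have h1 : HasDerivAt (fun s : ℝ => Complex.I * (Real.exp (s * L) : ℂ))
          (Complex.I * (Real.exp (t * L) * L : ℝ)) (t : ℝ) := by
        have := ((hasDerivAt_id (t : ℝ)).mul_const L).exp
        simp only [id, one_mul] at this
        exact this.ofReal_comp.const_mul Complex.I
      have h2 := (hasDerivAt_moebius k (y t)).comp (t : ℝ) h1
      refine (h2.hasDerivWithinAt (s := Set.Icc 0 1)).congr_deriv ?_ |>.congr (fun s hs => ?_) ?_
      · change _ = (L : ℂ) * ((Complex.I * (Real.exp (t * L) : ℂ)) / cdenom k (y t) ^ 2)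
        rw [Complex.ofReal_mul]
        ring
      · change ((k • y (Set.projIcc 0 1 zero_le_one s) : ℍ) : ℂ) = _
        rw [Set.projIcc_of_mem zero_le_one hs]
        exact UpperHalfPlane.coe_specialLinearGroup_apply k (y s)
      · change ((k • y (Set.projIcc 0 1 zero_le_one (t : ℝ)) : ℍ) : ℂ) = _
        rw [Set.projIcc_val]
        exact UpperHalfPlane.coe_specialLinearGroup_apply k (y t)

/-! ### The twist and Milnor's angle -/

/-- Both f and the constant f 0 lift the same constant path through the covering ℝ → `Circle`. -/
theorem sub_eq_sub_of_exp_mul_I_eq {f : C(I, ℝ)} {w : ℂ}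
    (h : ∀ t, Complex.exp (f t * Complex.I) = w) : f 1 = f 0 := by
  have hc : Circle.exp ∘ f = Circle.exp ∘ fun _ => f 0 := by
    funext t
    refine Subtype.ext ?_
    simp [Circle.coe_exp, h]
  exact congrFun (Circle.isAddQuotientCoveringMap_exp.isCoveringMap.eq_of_comp_eq
    f.continuous continuous_const hc 0 rfl) 1

theorem IsTwist.eq_two_mul_milnorTheta {α : PSLTilde} {τ : ℝ}
    (h : IsTwist α UpperHalfPlane.I τ) : τ = 2 * milnorTheta α := by
  obtain ⟨V, hV0, hV, hgeo, e, θ, he, hθ, rfl⟩ := h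
  obtain ⟨ψ, rfl, hψ⟩ := hV.exists_polarClass
  rw [milnorTheta_polarClass]
  have hbase (t : I) : (V t).base = (ψ.1 t).1 := by
    rw [hψ, base_smul, hV0, polarMap_smul_I]
  have hψ0 : (ψ.1 0).2 = 0 := by rw [ψ.2]
  have he0 : e 0 ≠ 0 := by
    rw [← norm_ne_zero_iff, he.1 0]
    exact (V 0).base.im_pos.ne'
  -- The transport factor is common to the velocity and the field, so exp(i f) is the constant ratio
  -- of their initial values.
  let f : C(I, ℝ) := ⟨fun t => θ t - 2 * (ψ.1 t).2, by fun_prop⟩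
  have hf (t : I) : Complex.exp (f t * Complex.I) = (V 0).vec / e 0 := by
    have h1 := hθ t
    rw [he.eq_transport hgeo hV0 t, hbase, hψ t, vec_polarMap_smul _ hV0] at h1
    have ht : transport (ψ.1 t).1 ≠ 0 := by
      rw [← transport_eq_cdenom]
      exact one_div_ne_zero (pow_ne_zero 2 (cdenom_ne_zero _ _))
    have h2 : Complex.exp (f t * Complex.I) * Complex.exp ((2 * (ψ.1 t).2 : ℝ) * Complex.I)
        = Complex.exp (θ t * Complex.I) := by
      rw [← Complex.exp_add, ← add_mul, ← Complex.ofReal_add]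
      simp [f]
    rw [← h2] at h1
    rw [eq_div_iff he0]
    refine mul_left_cancel₀ (mul_ne_zero (Complex.exp_ne_zero ((2 * (ψ.1 t).2 : ℝ) * Complex.I)) ht) ?_
    linear_combination -h1
  have := sub_eq_sub_of_exp_mul_I_eq hf
  simp only [f, ContinuousMap.coe_mk, hψ0] at this
  linarith

theorem exists_isTwist (α : PSLTilde) : ∃ τ, IsTwist α UpperHalfPlane.I τ := by
  obtain ⟨ψ, rfl⟩ := polarClass_surjective α
  obtain ⟨c, e, hc0, hc1, hgeo, he⟩ := exists_geodesic (ψ.1 1).1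
  -- Any path from 0 to the prescribed final angle would do.
  let φ : C(I, ℝ) := ⟨fun t => t * (ψ.1 1).2, by fun_prop⟩
  let ψ' : BasedPath (ℍ × ℝ) (UpperHalfPlane.I, 0) := ⟨c.prodMk φ, by simp [hc0, φ]⟩
  have hψ' : polarClass ψ = polarClass ψ' := polarClass_eq (by simp [ψ', φ, hc1])
  have hn : ‖e 0‖ = UpperHalfPlane.I.im := by rw [he.1 0, hc0]
  -- Starting the field at the velocity itself makes the angle exactly 2φ.
  let u : UTH := ⟨(UpperHalfPlane.I, e 0), hn⟩
  have hbase (t : I) : (polarMap (ψ'.1 t) • u).base = c t := polarMap_smul_I (ψ'.1 t)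
  have hvec (t : I) : (polarMap (ψ'.1 t) • u).vec
      = Complex.exp ((2 * φ t : ℝ) * Complex.I) * e t := by
    rw [vec_polarMap_smul _ rfl, he.eq_transport hgeo hc0 t]
    rfl
  have hcont : Continuous fun t => polarMap (ψ'.1 t) • u := by
    refine Continuous.subtype_mk (f := fun t =>
      ((polarMap (ψ'.1 t) • u).base, (polarMap (ψ'.1 t) • u).vec)) ?_ _
    have hd : Continuous fun t => cdenom (polarMap (ψ'.1 t)) UpperHalfPlane.I := by
      have hp (i j : Fin 2) : Continuous fun t => ((polarMap (ψ'.1 t) i j : ℝ) : ℂ) :=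
        Complex.continuous_ofReal.comp <|
          (show Continuous fun A : SL(2, ℝ) => A i j by fun_prop).comp
            (polarMap.continuous.comp ψ'.1.continuous)
      exact ((hp 1 0).mul continuous_const).add (hp 1 1)
    simp only [hbase]
    exact c.continuous.prodMk (continuous_const.div (hd.pow 2)
      fun t => pow_ne_zero 2 (cdenom_ne_zero _ _))
  let V : C(I, UTH) := ⟨fun t => polarMap (ψ'.1 t) • u, hcont⟩
  have hV0 : V 0 = u := by
    change polarMap (ψ'.1 0) • u = u
    rw [ψ'.2, polarMap_base, one_smul]
  have hVb : (fun t => (V t).base) = c := funext hbase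
  refine ⟨_, V, by rw [hV0]; rfl, ?_, by rwa [hVb], e,
    ⟨fun t => 2 * φ t, by fun_prop⟩, by rwa [hVb], hvec, rfl⟩
  rw [hψ']
  refine liesInClass_polarClass fun t => ?_
  rw [hV0]
  rfl

end HypTwist

theorem mainTheorem11 (α : HypTwist.PSLTilde) :
    (∃! τ : ℝ, HypTwist.IsTwist α UpperHalfPlane.I τ) ∧
      HypTwist.milnorTheta α = 1 / 2 * HypTwist.twist α UpperHalfPlane.I := by
  have h := HypTwist.exists_isTwist α
  refine ⟨h.imp fun τ hτ => ⟨hτ, fun τ' hτ' => ?_⟩, ?_⟩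
  · rw [hτ.eq_two_mul_milnorTheta, hτ'.eq_two_mul_milnorTheta]
  · rw [HypTwist.twist, dif_pos h, h.choose_spec.eq_two_mul_milnorTheta]
    ring
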